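/- Let $A$ be a finite ring with identity and let $R$ be a subring of $A$ (with the same identity) contained in the centre of $A$, such that $A$ is a free $R$-module with ordered basis $\mathcal B=(v_1,\dots,v_r)$. Let $\sigma$ be an involution of $A$, that is, an additive bijection $\sigma:A\to A$ with $\sigma(1)=1$, $\sigma(ab)=\sigma(b)\sigma(a)$ and $\sigma(\sigma(a))=a$ for all $a,b\in A$, and assume $\sigma(R)=R$. A finite ring $S$ is called Frobenius if $S/\operatorname{rad}(S)\cong\operatorname{Soc}({}_SS)$ as left $S$-modules and $S/\operatorname{rad}(S)\cong\operatorname{Soc}(S_S)$ as right $S$-modules, where $\operatorname{rad}(S)$ is the Jacobson radical and $\operatorname{Soc}$ denotes the socle (the sum of the simple submodules). Define $\rho:A\to R^r$ by $\rho(a_1v_1+\dots+a_rv_r)=(a_1,\dots,a_r)$ for $a_1,\dots,a_r\in R$, and for $n\in\mathbb N$ define $\Phi:A^n\to R^{rn}$ by $\Phi(\alpha_1,\dots,\alpha_n)=(\rho(\alpha_1),\dots,\rho(\alpha_n))$. For $a\in A$ let $M_a$ be the $r\times r$ matrix over $R$ whose $i$-th row is $\rho(v_ia)$. The basis $\mathcal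 B$ is called symmetric if $M_{v}=M_{v}^{T}$ for every $v\in\mathcal B$. For $S\in\{A,R\}$, $k\in\mathbb N$ and a subset $D\subseteq S^k$, put $D^\perp=\{x\in S^k : \sum_{i=1}^k x_i\,\sigma(c_i)=0\text{ for all }c\in D\}$. Assume that $\mathcal B$ is symmetric. Then $A$ is commutative. If moreover $A$ and $R$ are Frobenius rings and $\sigma(v_i)=v_i$ for $i=1,\dots,r$, then for every $n\in\mathbb N$ and every linear code $C$ of length $n$ over $A$ (that is, every left $A$-submodule $C$ of $A^n$), $$\Phi(C^\perp)=\Phi(C)^\perp .$$ -/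

import Mathlib

noncomputable section

/-- The socle of a module: the sum of its simple submodules. -/
def moduleSocle (S M : Type*) [Ring S] [AddCommGroup M] [Module S M] : Submodule S M :=
  sSup {N : Submodule S M | IsSimpleModule S N}

/-- A (finite) ring `S` is Frobenius if `S / rad S` is isomorphic to the socle of `S`, both as
left `S`-modules and as right `S`-modules. Right modules are modules over `Sᵐᵒᵖ`, and the Jacobson
radical is the intersection of the maximal left ideals, and also that of the maximal right
ideals. -/
def IsFrobeniusRing (S : Type*) [Ring S] : Prop :=
  Nonempty ((S ⧸ Module.jacobson S S) ≃ₗ[S] moduleSocle S S) ∧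
  Nonempty ((S ⧸ Module.jacobson Sᵐᵒᵖ S) ≃ₗ[Sᵐᵒᵖ] moduleSocle Sᵐᵒᵖ S)

/-- The standard `σ`-hermitian form `⟨x, y⟩ = ∑ i, x i * σ (y i)` on `S ^ k`. -/
def hermForm {S : Type*} [Ring S] (σ : RingInvo S) {k : ℕ} (x y : Fin k → S) : S :=
  ∑ i, x i * (σ (y i)).unop

/-- The dual code `C^⊥ = {v | ⟨v, c⟩ = 0 for all c ∈ C}` for the standard `σ`-hermitian form. -/
def dualCode {S : Type*} [Ring S] (σ : RingInvo S) {k : ℕ} (C : Set (Fin k → S)) :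
    Set (Fin k → S) :=
  {v | ∀ c ∈ C, hermForm σ v c = 0}

/-- The restriction to a subring `R` with `σ(R) = R` of an involution `σ`. -/
def restrictInvo {A : Type*} [Ring A] (σ : RingInvo A) (R : Subring A)
    (hσR : (fun a : A => (σ a).unop) '' (R : Set A) = (R : Set A)) : RingInvo R :=
  RingInvo.mk'
    { toFun := fun a => MulOpposite.op
        ⟨(σ (a : A)).unop, hσR.subset (Set.mem_image_of_mem (fun a : A => (σ a).unop) a.2)⟩
      map_one' := by
        apply MulOpposite.unop_injective; ext; simp
      map_mul' := fun a b => by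
        apply MulOpposite.unop_injective; ext; simp
      map_zero' := by
        apply MulOpposite.unop_injective; ext; simp
      map_add' := fun a b => by
        apply MulOpposite.unop_injective; ext; simp }
    (fun a => by ext; simp)

/-- The component map `ρ : A → R ^ r`, `∑ j, a j • v j ↦ (a 1, …, a r)`, where `v` is the ordered
left `R`-basis. -/
def rhoMap {A : Type*} [Ring A] {R : Subring A} {r : ℕ} (v : Module.Basis (Fin r) R A) (a : A) :
    Fin r → R :=
  fun j => v.repr a j

/-- The map `Φ : A ^ n → R ^ (n * r)`, `(α 1, …, α n) ↦ (ρ (α 1), …, ρ (α n))`: the entry at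
position `k` is entry number `k % r` of block number `k / r`. -/
def phiMap {A : Type*} [Ring A] {R : Subring A} {r : ℕ} (v : Module.Basis (Fin r) R A) (n : ℕ)
    (x : Fin n → A) : Fin (n * r) → R :=
  fun k => rhoMap v (x k.divNat) k.modNat

/-- The matrix `M_a` of right multiplication by `a`: its `i`-th row is `ρ (v i * a)`. -/
def rightMulMatrix {A : Type*} [Ring A] {R : Subring A} {r : ℕ} (v : Module.Basis (Fin r) R A)
    (a : A) : Matrix (Fin r) (Fin r) R :=
  Matrix.of fun i => rhoMap v (v i * a)

/-- The basis `v` is symmetric: `M_u` is a symmetric matrix for every basis element `u`. -/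
def IsSymmetricBasis {A : Type*} [Ring A] {R : Subring A} {r : ℕ}
    (v : Module.Basis (Fin r) R A) : Prop :=
  ∀ k, rightMulMatrix v (v k) = (rightMulMatrix v (v k)).transpose

end

/-!
Write `1 = ∑ j, e j • v j` and let `τ : A → R` be `τ a = ∑ j, e j * ρ(a) j`.

Since `a ↦ M_a` is additive and `R`-linear, symmetry of the matrices `M_{v k}` makes every `M_a`
symmetric. As `M_{ab} = M_a M_b`, transposing gives `M_{ab} = M_{ba}`, and `a` is recovered from
`M_a`, so `A` is commutative.

Symmetry also gives the key identity `τ (a * b) = ρ(a) ⬝ᵥ ρ(b)` (`traceForm_mul`): the coordinate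
`j` of `a * b` weighted by `e j` becomes, after transposing `M_b`, the coordinates of `1 * b` paired
with those of `a`. Since `σ` fixes the basis, `ρ` intertwines `σ` on `A` with `σ` on `R`, hence
`⟨Φ x, Φ y⟩ = τ ⟨x, y⟩` (`hermForm_phiMap`). So `Φ x` is orthogonal to `Φ(C)` exactly when `τ`
vanishes on `⟨x, c⟩` for all `c ∈ C`. Since `C` is a submodule, `τ` then vanishes on the ideal
`⟨x, c⟩ A`, and nondegeneracy of `(a, b) ↦ τ (a * b)` forces `⟨x, c⟩ = 0`.
-/

noncomputable section

variable {A : Type*} [Ring A] {R : Subring A} {r : ℕ} (v : Module.Basis (Fin r) R A)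

theorem mul_smul_of_le_center (hR : R ≤ Subring.center A) (c : R) (a b : A) :
    a * (c • b) = c • (a * b) := by
  simp only [Subring.smul_def, smul_eq_mul]
  rw [← mul_assoc, Subring.mem_center_iff.1 (hR c.2) a, mul_assoc]

theorem coe_mul_comm_of_le_center (hR : R ≤ Subring.center A) (c d : R) : c * d = d * c :=
  Subtype.ext (Subring.mem_center_iff.1 (hR d.2) c)

/-- Symmetry of `M_u` for basis elements `u` extends to all of `A` by linearity. -/
theorem IsSymmetricBasis.repr_mul_comm {v : Module.Basis (Fin r) R A} (hv : IsSymmetricBasis v)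
    (hR : R ≤ Subring.center A) (a : A) (i j : Fin r) :
    v.repr (v i * a) j = v.repr (v j * a) i := by
  have key (k : Fin r) : v.repr (v i * v k) j = v.repr (v j * v k) i := congrFun₂ (hv k) i j
  rw [← v.sum_repr a]
  simp only [Finset.mul_sum, mul_smul_of_le_center hR, map_sum, map_smul, Finsupp.coe_finsetSum,
    Finset.sum_apply, Finsupp.smul_apply, key]

theorem repr_mul (a b : A) (j : Fin r) :
    v.repr (a * b) j = ∑ k, v.repr a k * v.repr (v k * b) j := by
  conv_lhs => rw [← v.sum_repr a]
  simp only [Finset.sum_mul, smul_mul_assoc, map_sum, map_smul, Finsupp.coe_finsetSum,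
    Finset.sum_apply, Finsupp.smul_apply, smul_eq_mul]

theorem IsSymmetricBasis.mul_comm {v : Module.Basis (Fin r) R A} (hv : IsSymmetricBasis v)
    (hR : R ≤ Subring.center A) (a b : A) : a * b = b * a := by
  have basis_mul (i : Fin r) : v i * (a * b) = v i * (b * a) := by
    apply v.repr.injective
    ext1 j
    rw [hv.repr_mul_comm hR (b * a), ← mul_assoc, ← mul_assoc, repr_mul v (v i * a),
      repr_mul v (v j * b)]
    refine Finset.sum_congr rfl fun k _ => ?_
    rw [hv.repr_mul_comm hR a i k, hv.repr_mul_comm hR b k j, coe_mul_comm_of_le_center hR]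
  have h : (1 : A) * (a * b) = 1 * (b * a) := by
    rw [← v.sum_repr 1]
    simp only [Finset.sum_mul, smul_mul_assoc, basis_mul]
  simpa using h

/-- The linear form `τ a = ∑ j, ρ(1) j * ρ(a) j`, for which a symmetric basis is self-dual under
the pairing `(a, b) ↦ τ (a * b)`. -/
def traceForm (a : A) : R := ∑ j, v.repr 1 j * v.repr a j

theorem traceForm_sum {ι : Type*} (s : Finset ι) (f : ι → A) :
    traceForm v (∑ i ∈ s, f i) = ∑ i ∈ s, traceForm v (f i) := by
  simp only [traceForm, map_sum, Finsupp.coe_finsetSum, Finset.sum_apply, Finset.mul_sum]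
  exact Finset.sum_comm

theorem traceForm_mul {v : Module.Basis (Fin r) R A} (hv : IsSymmetricBasis v)
    (hR : R ≤ Subring.center A) (a b : A) :
    traceForm v (a * b) = ∑ i, v.repr a i * v.repr b i := by
  have hb (k : Fin r) : v.repr b k = ∑ j, v.repr 1 j * v.repr (v k * b) j := by
    conv_lhs => rw [← one_mul b, repr_mul v 1 b k]
    simp only [hv.repr_mul_comm hR b k]
  simp only [traceForm, repr_mul v a b, hb, Finset.mul_sum]
  rw [Finset.sum_comm]
  refine Finset.sum_congr rfl fun k _ => Finset.sum_congr rfl fun j _ => ?_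
  rw [← mul_assoc, ← mul_assoc, coe_mul_comm_of_le_center hR (v.repr 1 j)]

theorem eq_zero_of_traceForm_mul_eq_zero {v : Module.Basis (Fin r) R A}
    (hv : IsSymmetricBasis v) (hR : R ≤ Subring.center A) {a : A}
    (h : ∀ b, traceForm v (a * b) = 0) : a = 0 := by
  apply v.repr.injective
  ext1 i
  have hi := h (v i)
  simpa [traceForm_mul hv hR, Finsupp.single_apply] using hi

theorem phiMap_surjective (n : ℕ) : Function.Surjective (phiMap v n) := by
  intro w
  refine ⟨fun i => v.equivFun.symm fun j => w (finProdFinEquiv (i, j)), ?_⟩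
  funext k
  change v.equivFun (v.equivFun.symm _) k.modNat = _
  rw [LinearEquiv.apply_symm_apply]
  exact congrArg w (finProdFinEquiv.apply_symm_apply k)

theorem repr_invo (hR : R ≤ Subring.center A) (σ : RingInvo A)
    (hσR : (fun a : A => (σ a).unop) '' (R : Set A) = (R : Set A))
    (hσv : ∀ k, (σ (v k)).unop = v k) (a : A) (j : Fin r) :
    v.repr (σ a).unop j = (restrictInvo σ R hσR (v.repr a j)).unop := by
  have h : (σ a).unop = ∑ i, (restrictInvo σ R hσR (v.repr a i)).unop • v i := by
    conv_lhs => rw [← v.sum_repr a]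
    rw [map_sum, Finset.unop_sum]
    refine Finset.sum_congr rfl fun i _ => ?_
    rw [Subring.smul_def, smul_eq_mul, map_mul, MulOpposite.unop_mul, hσv, Subring.smul_def,
      smul_eq_mul]
    exact Subring.mem_center_iff.1 (hR (restrictInvo σ R hσR (v.repr a i)).unop.2) (v i)
  rw [h, v.repr_sum_self]

theorem hermForm_phiMap {v : Module.Basis (Fin r) R A} (hv : IsSymmetricBasis v)
    (hR : R ≤ Subring.center A) (σ : RingInvo A)
    (hσR : (fun a : A => (σ a).unop) '' (R : Set A) = (R : Set A))
    (hσv : ∀ k, (σ (v k)).unop = v k) {n : ℕ} (x y : Fin n → A) :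
    hermForm (restrictInvo σ R hσR) (phiMap v n x) (phiMap v n y) =
      traceForm v (hermForm σ x y) := by
  simp only [hermForm, phiMap, rhoMap, traceForm_sum, traceForm_mul hv hR,
    repr_invo v hR σ hσR hσv]
  rw [← Fintype.sum_prod_type' (f := fun i j =>
    v.repr (x i) j * (restrictInvo σ R hσR (v.repr (y i) j)).unop)]
  exact finProdFinEquiv.symm.sum_comp fun p : Fin n × Fin r =>
    v.repr (x p.1) p.2 * (restrictInvo σ R hσR (v.repr (y p.1) p.2)).unop

theorem hermForm_smul_right {n : ℕ} (σ : RingInvo A) (b : A) (x y : Fin n → A) :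
    hermForm σ x (b • y) = hermForm σ x y * (σ b).unop := by
  simp [hermForm, Finset.sum_mul, mul_assoc]

end

theorem theorem3p13 {A : Type*} [Ring A] [Finite A]
    (R : Subring A) (hR : R ≤ Subring.center A)
    {r : ℕ} (v : Module.Basis (Fin r) R A) (hv : IsSymmetricBasis v) :
    (∀ a b : A, a * b = b * a) ∧
    ∀ (σ : RingInvo A) (hσR : (fun a : A => (σ a).unop) '' (R : Set A) = (R : Set A)),
      (∀ k, (σ (v k)).unop = v k) → IsFrobeniusRing A → IsFrobeniusRing R →
      ∀ (n : ℕ) (C : Submodule A (Fin n → A)),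
        phiMap v n '' dualCode σ (C : Set (Fin n → A)) =
          dualCode (restrictInvo σ R hσR) (phiMap v n '' (C : Set (Fin n → A))) := by
  refine ⟨hv.mul_comm hR, fun σ hσR hσv _ _ n C => Set.Subset.antisymm ?_ ?_⟩
  · rintro _ ⟨x, hx, rfl⟩ _ ⟨c, hc, rfl⟩
    rw [hermForm_phiMap hv hR σ hσR hσv, hx c hc]
    simp [traceForm]
  · intro w hw
    obtain ⟨x, rfl⟩ := phiMap_surjective v n w
    refine ⟨x, fun c hc => eq_zero_of_traceForm_mul_eq_zero hv hR fun b => ?_, rfl⟩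
    -- `b = σ (σ b)`, so the value at `b` is the pairing of `Φ x` with `Φ` of a multiple of `c`.
    have h := hw _ ⟨(σ b).unop • c, C.smul_mem _ hc, rfl⟩
    rwa [hermForm_phiMap hv hR σ hσR hσv, hermForm_smul_right, RingInvo.involution] at h
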